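/- **Conventions.** Let $L$ be a language. An *abstract elementary class* (AEC) in $L$ is a class $K$ of $L$-structures with a partial order $\prec_K$ refining the substructure relation such that: (i) $K$ and $\prec_K$ are closed under $L$-isomorphism; (ii) (coherence) if $M_0\prec_K M_2$, $M_1\prec_K M_2$ and $M_0\subseteq M_1$, then $M_0\prec_K M_1$; (iii) if $\langle M_i : i<\alpha\rangle$ ($\alpha>0$) is a $\prec_K$-increasing continuous chain, then $\bigcup_i M_i\in K$, every $M_i\prec_K\bigcup_j M_j$, and if $M_i\prec_K N$ for all $i$ then $\bigcup_i M_i\prec_K N$; (iv) there is a least cardinal $\mathrm{LS}(K)\ge |L|+\aleph_0$ such that for all $M\in K$ and $A\subseteq |M|$ there is $N\prec_K M$ with $A\subseteq |N|$ and $\|N\|\le |A|+\mathrm{LS}(K)$. All AECs are assumed to have no models of size less than $\mathrm{LS}(K)$. A *$K$-embedding* $f:M\to N$ is an $L$-embedding with $f(M)\prec_K N$. For $M\in K$ and an index set $J$, a *pretype* over $M$ is a triple $(\langle a_j : j\in J\rangle, M,N)$ with $M\prec_K N$ and all $a_j\in |N|$. Write $(\bar a,M,N)\sim_{AT}(\bar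 b,M,N')$ if there are $K$-embeddings $f:N\to N^*$ and $g:N'\to N^*$ that agree on $M$ with $f(a_j)=g(b_j)$ for all $j\in J$, and let $\sim$ be the transitive closure of $\sim_{AT}$. The *Galois type* $\mathrm{tp}(\bar a/M,N)$ is the $\sim$-class of $(\bar a,M,N)$, and $S^J(M)$ is the collection of all of these. An uncountable cardinal $\kappa$ is *strongly compact* if every $\kappa$-complete proper filter on any set extends to a $\kappa$-complete ultrafilter. Let $M\in K$ and let $I$ be a linear order. A *small type* is a type $p\in S^{I_0}(M^-)$ where $I_0\subseteq I$, $|I_0|<\kappa$, $M^-\prec_K M$ and $\|M^-\|<\kappa$. If $M\prec_K N$ and $\bar a=\langle a_i : i\in I\rangle$ is a sequence in $N$, then $\bar a$ *realizes* $p$ (in $N$) if $\mathrm{tp}(\langle a_i : i\in I_0\rangle/M^-,N)=p$. For sets $X$ and $\neg X$ of small types ($\neg X$ is just the name of a second set), the pair $(X,\neg X)$ is *consistent* if there are some $N$ with $M\prec_K N$ and a single sequence $\langle a_i : i\in I\rangle$ in $N$ that realizes every $p\in X$ and realizes no $q\in\neg X$. It is *$<\kappa$ consistent* if $(X_0,\neg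 X_0)$ is consistent for all $X_0\subseteq X$ and $\neg X_0\subseteq\neg X$ with $|X_0|,|\neg X_0|<\kappa$. **Theorem.** Let $K$ be an AEC with $\mathrm{LS}(K)<\kappa$, where $\kappa$ is strongly compact. Let $M\in K$, let $I$ be a linear order, and let $X$ and $\neg X$ be sets of small types as above. Then $(X,\neg X)$ is consistent if and only if it is $<\kappa$ consistent. -/

import Mathlib

open Cardinal
open scoped FirstOrder

universe u

/-- A class of `L`-structures with a relation "is a strong submodel of". `Mod M` says that `M` is in
the class; `Strong S` says that the substructure `S` of `N` satisfies `S ≺_K N`. -/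
structure StructureClass (L : FirstOrder.Language.{u, u}) where
  Mod : ∀ (M : Type u) [L.Structure M], Prop
  Strong : ∀ {N : Type u} [L.Structure N], L.Substructure N → Prop

/-- `S ≺_K T`, for two substructures `S`, `T` of a common `L`-structure (which need not itself
be in the class). -/
def StructureClass.SubLE {L : FirstOrder.Language.{u, u}} (K : StructureClass L) {N : Type u} [L.Structure N]
    (S T : L.Substructure N) : Prop :=
  S ≤ T ∧ K.Strong (S.comap T.subtype.toHom)

/-- `lam ≥ |L| + ℵ₀`, and every subset `A` of a model `M` is contained in some `N ≺_K M` with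
`‖N‖ ≤ |A| + lam`. -/
def StructureClass.IsLSBound {L : FirstOrder.Language.{u, u}} (K : StructureClass L)
    (lam : Cardinal.{u}) : Prop :=
  L.card + ℵ₀ ≤ lam ∧
    ∀ (M : Type u) [L.Structure M], K.Mod M → ∀ A : Set M,
      ∃ N : L.Substructure M, K.Strong N ∧ A ⊆ (N : Set M) ∧ #N ≤ #A + lam

/-- An abstract elementary class. A chain of models is a family of substructures, indexed by a
nonempty well-order, of some `L`-structure; since such a family is directed, its supremum is its
union. -/
structure AEC (L : FirstOrder.Language.{u, u}) extends StructureClass L where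
  mod_of_strong : ∀ {N : Type u} [L.Structure N] {S : L.Substructure N},
    Strong S → Mod S ∧ Mod N
  strong_refl : ∀ {N : Type u} [L.Structure N], Mod N → Strong (⊤ : L.Substructure N)
  strong_trans : ∀ {N : Type u} [L.Structure N] {S T : L.Substructure N},
    toStructureClass.SubLE S T → Strong T → Strong S
  mod_iso : ∀ {N N' : Type u} [L.Structure N] [L.Structure N'], (N ≃[L] N') → Mod N → Mod N'
  strong_iso : ∀ {N N' : Type u} [L.Structure N] [L.Structure N'] (e : N ≃[L] N')
    {S : L.Substructure N}, Strong S → Strong (S.map e.toHom)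
  coherence : ∀ {N : Type u} [L.Structure N] {S T : L.Substructure N},
    Strong S → Strong T → S ≤ T → toStructureClass.SubLE S T
  union_chain : ∀ {N : Type u} [L.Structure N] {ι : Type u} [LinearOrder ι] [WellFoundedLT ι]
    [Nonempty ι] (S : ι → L.Substructure N), (∀ i, Mod (S i)) →
    (∀ i j, i ≤ j → toStructureClass.SubLE (S i) (S j)) →
    (∀ i, Order.IsSuccLimit i → S i = ⨆ j : Set.Iio i, S j) →
    Mod (⨆ i, S i : L.Substructure N) ∧ (∀ i, toStructureClass.SubLE (S i) (⨆ i, S i)) ∧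
      ((∀ i, Strong (S i)) → Strong (⨆ i, S i))
  exists_isLSBound : ∃ lam, toStructureClass.IsLSBound lam

namespace AEC

variable {L : FirstOrder.Language.{u, u}} (K : AEC L)

/-- The Löwenheim–Skolem number `LS(K)`. -/
noncomputable def LS : Cardinal.{u} := sInf {lam | K.IsLSBound lam}

/-- `f` is a `K`-embedding. -/
def IsEmb {M N : Type u} [L.Structure M] [L.Structure N] (f : M ↪[L] N) : Prop :=
  K.Strong f.toHom.range

variable {K}

theorem IsEmb.refl {N : Type u} [L.Structure N] (h : K.Mod N) :
    K.IsEmb (FirstOrder.Language.Embedding.refl L N) := by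
  have : (FirstOrder.Language.Embedding.refl L N).toHom.range = ⊤ := by
    ext x
    simp
  unfold IsEmb
  rw [this]
  exact K.strong_refl h

theorem isEmb_subtype {N : Type u} [L.Structure N] {S : L.Substructure N} (h : K.Strong S) :
    K.IsEmb S.subtype := by
  unfold IsEmb
  rwa [show S.subtype.toHom.range = S from FirstOrder.Language.Substructure.range_subtype S]

theorem IsEmb.comp {M N P : Type u} [L.Structure M] [L.Structure N] [L.Structure P]
    {f : M ↪[L] N} {g : N ↪[L] P} (hg : K.IsEmb g) (hf : K.IsEmb f) : K.IsEmb (g.comp f) := by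
  refine K.strong_trans (T := g.toHom.range) ⟨?_, ?_⟩ hg
  · rintro _ ⟨x, rfl⟩
    exact ⟨f x, rfl⟩
  · have h := K.strong_iso g.equivRange hf
    convert h using 1
    ext ⟨y, hy⟩
    constructor
    · rintro ⟨x, hx⟩
      exact ⟨f x, ⟨x, rfl⟩, Subtype.ext hx⟩
    · rintro ⟨_, ⟨x, rfl⟩, hx⟩
      exact ⟨x, congrArg Subtype.val hx⟩

variable (K)

/-- A pretype `(⟨a_j : j ∈ J⟩, M, N)` over `M`: `N` is a strong extension of `M` (given through a
`K`-embedding of `M`) containing all the `a_j`. -/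
structure Pretype (M : Type u) [L.Structure M] (J : Type u) : Type (u + 1) where
  carrier : Type u
  [str : L.Structure carrier]
  emb : M ↪[L] carrier
  isEmb : K.IsEmb emb
  seq : J → carrier

attribute [instance] Pretype.str

variable {K} {M : Type u} [L.Structure M] {J : Type u}

/-- Atomic equivalence `∼_AT`: two pretypes over `M` can be amalgamated over `M` so that their
sequences are identified. -/
def Pretype.AT (p q : K.Pretype M J) : Prop :=
  ∃ (P : Type u) (_ : L.Structure P) (f : p.carrier ↪[L] P) (g : q.carrier ↪[L] P),
    K.IsEmb f ∧ K.IsEmb g ∧ (∀ m, f (p.emb m) = g (q.emb m)) ∧ ∀ j, f (p.seq j) = g (q.seq j)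

theorem Pretype.AT.refl (p : K.Pretype M J) : p.AT p :=
  have h := IsEmb.refl (K.mod_of_strong p.isEmb).2
  ⟨p.carrier, p.str, _, _, h, h, fun _ => rfl, fun _ => rfl⟩

theorem Pretype.AT.symm {p q : K.Pretype M J} (h : p.AT q) : q.AT p := by
  obtain ⟨P, _, f, g, hf, hg, h1, h2⟩ := h
  exact ⟨P, _, g, f, hg, hf, fun m => (h1 m).symm, fun j => (h2 j).symm⟩

variable (K M J)

/-- The transitive closure of `∼_AT`. -/
def Pretype.setoid : Setoid (K.Pretype M J) where
  r := Relation.TransGen Pretype.AT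
  iseqv :=
    { refl := fun p => .single (.refl p)
      symm := fun h => by
        induction h with
        | single h => exact .single h.symm
        | tail _ h ih => exact .head h.symm ih
      trans := fun h h' => h.trans h' }

/-- `S^J(M)`: the Galois types over `M` of length `J`. -/
def GaloisType : Type (u + 1) := Quotient (Pretype.setoid K M J)

variable {K M J}

/-- `tp(⟨a_j : j ∈ J⟩ / M, N)`, where `M` is embedded in `N` by the `K`-embedding `e`. -/
def tp {N : Type u} [L.Structure N] (e : M ↪[L] N) (he : K.IsEmb e) (a : J → N) :
    K.GaloisType M J :=
  Quotient.mk (Pretype.setoid K M J) { carrier := N, emb := e, isEmb := he, seq := a }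

variable (K M)

/-- The disjoint union of the sets `S^{I₀}(M⁻)` over all `I₀ ∈ P_κ I` and `M⁻ ∈ P*_κ M`, that is,
`I₀ ⊆ I` with `|I₀| < κ` and `M⁻ ≺_K M` with `‖M⁻‖ < κ`. -/
structure SmallType (κ : Cardinal.{u}) (I : Type u) : Type (u + 1) where
  length : Set I
  length_lt : #length < κ
  dom : L.Substructure M
  strong_dom : K.Strong dom
  dom_lt : #dom < κ
  type : K.GaloisType dom length

variable {K M} {κ : Cardinal.{u}} {I : Type u}

/-- The restriction `⟨a_i : i ∈ ℓ(p)⟩` of a sequence `a` in a strong extension `N` of `M` (given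
by `e : M → N`) realizes the small type `p`. -/
def SmallType.RealizedBy (p : K.SmallType M κ I) {N : Type u} [L.Structure N] (e : M ↪[L] N)
    (he : K.IsEmb e) (a : I → N) : Prop :=
  tp (e.comp p.dom.subtype) (he.comp (isEmb_subtype p.strong_dom)) (fun i : p.length => a i) =
    p.type

/-- `(X, ¬X)` is consistent: in some strong extension of `M` there is a sequence indexed by `I`
that realizes every type in `X` and no type in `Y = ¬X`. -/
def Consistent (X Y : Set (K.SmallType M κ I)) : Prop :=
  ∃ (N : Type u) (_ : L.Structure N) (e : M ↪[L] N) (he : K.IsEmb e) (a : I → N),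
    (∀ p ∈ X, p.RealizedBy e he a) ∧ ∀ q ∈ Y, ¬ q.RealizedBy e he a

/-- `(X, ¬X)` is `< κ` consistent. -/
def LTConsistent (X Y : Set (K.SmallType M κ I)) : Prop :=
  ∀ X₀ Y₀ : Set (K.SmallType M κ I), X₀ ⊆ X → Y₀ ⊆ Y →
    #X₀ < Cardinal.lift.{u + 1} κ → #Y₀ < Cardinal.lift.{u + 1} κ → Consistent X₀ Y₀

end AEC

/-- An uncountable cardinal `κ` is strongly compact if every (proper) `κ`-complete filter on a set
extends to a `κ`-complete ultrafilter. -/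
def IsStronglyCompact (κ : Cardinal.{u}) : Prop :=
  ℵ₀ < κ ∧ ∀ (α : Type u) (F : Filter α), F.NeBot → CardinalInterFilter F κ →
    ∃ U : Ultrafilter α, (U : Filter α) ≤ F ∧ CardinalInterFilter (U : Filter α) κ

/-! Only the passage from `< κ` consistency to consistency needs work, and there the witness is an
ultraproduct. Let `B` be a copy of the set of small types and `U` a fine `κ`-complete ultrafilter on
`P_κ B`. For each `Z` in `P_κ B` choose a model and a sequence that witness consistency of the part
of `(X, Y)` lying in `Z`. By fineness almost every `Z` contains a given `p`, so the sequence of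
classes in the ultraproduct works as soon as a small type is realized there exactly when it is
realized in almost every factor (`eventually_realizedBy_iff`).

This form of Łoś's theorem is proved without syntax. If `A i` are substructures of size at most `μ <
κ`, then by `κ`-completeness evaluation at `i` is, for almost all `i`, an isomorphism from the
internal product of the `A i` onto `A i` (`eventually_exists_equiv_internalSubstructure`). By
Löwenheim–Skolem the ultraproduct is the directed union of such products with the `A i` strong, and
AECs are closed under directed unions (`iSup_directed`). Hence the ultraproduct is in `K`, the small
internal products are strong in it (`mod_ultraproduct`), and the diagonal map is a `K`-embedding
(`isEmb_diagonal`). A small type involves fewer than `κ` elements, so it can be computed inside one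
small internal product. -/

namespace AEC

open FirstOrder.Language

variable {L : FirstOrder.Language.{u, u}} {K : AEC L}

/-! ### Calculus of `K`-embeddings and of `SubLE` -/

section Basic

variable {M N P : Type u} [L.Structure M] [L.Structure N] [L.Structure P]

theorem comap_subtype_eq_range_inclusion {S T : L.Substructure N} (h : S ≤ T) :
    S.comap T.subtype.toHom = (Substructure.inclusion h).toHom.range := by
  ext x
  constructor
  · intro hx
    exact ⟨⟨x, hx⟩, rfl⟩
  · rintro ⟨y, rfl⟩
    exact y.2

theorem subLE_iff_isEmb_inclusion {S T : L.Substructure N} (h : S ≤ T) :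
    K.SubLE S T ↔ K.IsEmb (Substructure.inclusion h) := by
  unfold StructureClass.SubLE IsEmb
  rw [comap_subtype_eq_range_inclusion h]
  exact and_iff_right h

theorem isEmb_equiv (e : M ≃[L] N) (hM : K.Mod M) : K.IsEmb e.toEmbedding := by
  have : e.toEmbedding.toHom.range = ⊤ := by
    rw [Hom.range_eq_top]
    exact e.surjective
  unfold IsEmb
  rw [this]
  exact K.strong_refl (K.mod_iso e hM)

theorem IsEmb.mod_left {f : M ↪[L] N} (hf : K.IsEmb f) : K.Mod M :=
  K.mod_iso f.equivRange.symm (K.mod_of_strong hf).1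

theorem IsEmb.mod_right {f : M ↪[L] N} (hf : K.IsEmb f) : K.Mod N :=
  (K.mod_of_strong hf).2

/-- This is coherence for the ranges of `g.comp f` and `g` in `P`, pulled back to `N` along `g`. -/
theorem IsEmb.of_comp {f : M ↪[L] N} {g : N ↪[L] P} (hgf : K.IsEmb (g.comp f))
    (hg : K.IsEmb g) : K.IsEmb f := by
  have hle : (g.comp f).toHom.range ≤ g.toHom.range := by
    rintro _ ⟨x, rfl⟩
    exact ⟨f x, rfl⟩
  have h := K.strong_iso g.equivRange.symm (K.coherence hgf hg hle).2
  unfold IsEmb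
  convert h using 1
  ext y
  constructor
  · rintro ⟨x, rfl⟩
    refine ⟨⟨g (f x), f x, rfl⟩, ⟨x, rfl⟩, ?_⟩
    exact g.equivRange.symm_apply_apply (f x)
  · rintro ⟨z, ⟨x, hx⟩, rfl⟩
    refine ⟨x, g.equivRange.injective ?_⟩
    refine Eq.trans ?_ (g.equivRange.apply_symm_apply z).symm
    exact Subtype.ext hx

theorem subLE_top_iff {S : L.Substructure N} : K.SubLE S ⊤ ↔ K.Strong S := by
  constructor
  · intro h
    have h' := K.strong_iso Substructure.topEquiv h.2
    convert h' using 1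
    ext x
    constructor
    · intro hx
      exact ⟨⟨x, trivial⟩, hx, rfl⟩
    · rintro ⟨y, hy, rfl⟩
      exact hy
  · intro h
    exact K.coherence h (K.strong_refl (K.mod_of_strong h).2) le_top

theorem SubLE.mod {S T : L.Substructure N} (h : K.SubLE S T) : K.Mod S ∧ K.Mod T :=
  have := (subLE_iff_isEmb_inclusion h.1).1 h
  ⟨this.mod_left, this.mod_right⟩

theorem SubLE.refl {S : L.Substructure N} (h : K.Mod S) : K.SubLE S S :=
  (subLE_iff_isEmb_inclusion le_rfl).2 (IsEmb.refl h)

theorem SubLE.trans {S T V : L.Substructure N} (h : K.SubLE S T) (h' : K.SubLE T V) :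
    K.SubLE S V :=
  (subLE_iff_isEmb_inclusion (h.1.trans h'.1)).2
    (((subLE_iff_isEmb_inclusion h'.1).1 h').comp ((subLE_iff_isEmb_inclusion h.1).1 h))

/-- `eT` after the inclusion of `S` equals the inclusion of `S'` after `eS`, a `K`-embedding; `eT`
is then cancelled by `IsEmb.of_comp`. -/
theorem SubLE.of_isEmb_square {S T : L.Substructure M} {S' T' : L.Substructure N} (hST : S ≤ T)
    (h : K.SubLE S' T') (eS : S ≃[L] S') (eT : T ≃[L] T')
    (heq : ∀ x : S, eT (Substructure.inclusion hST x) = Substructure.inclusion h.1 (eS x)) :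
    K.SubLE S T := by
  rw [subLE_iff_isEmb_inclusion hST]
  have hT := K.mod_iso eT.symm (SubLE.mod h).2
  refine IsEmb.of_comp (g := eT.toEmbedding) ?_ (isEmb_equiv eT hT)
  have h' := ((subLE_iff_isEmb_inclusion h.1).1 h).comp
    (isEmb_equiv eS (K.mod_iso eS.symm (SubLE.mod h).1))
  convert h' using 1
  ext x
  exact congrArg Subtype.val (heq x)

theorem subLE_map_iff (f : M ↪[L] N) {S T : L.Substructure M} :
    K.SubLE (S.map f.toHom) (T.map f.toHom) ↔ K.SubLE S T := by
  constructor
  · intro h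
    have hST : S ≤ T := (Substructure.map_le_map_iff_of_injective (f := f.toHom) f.injective).1 h.1
    exact SubLE.of_isEmb_square hST h (f.substructureEquivMap S) (f.substructureEquivMap T)
      fun x => rfl
  · intro h
    refine SubLE.of_isEmb_square (Substructure.monotone_map h.1) h
      (f.substructureEquivMap S).symm (f.substructureEquivMap T).symm fun x => ?_
    obtain ⟨y, rfl⟩ := (f.substructureEquivMap S).surjective x
    rw [FirstOrder.Language.Equiv.symm_apply_apply]
    exact (f.substructureEquivMap T).symm_apply_apply (Substructure.inclusion h.1 y)

theorem map_comap_subtype {S V : L.Substructure N} (h : S ≤ V) :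
    (S.comap V.subtype.toHom).map V.subtype.toHom = S := by
  ext x
  constructor
  · rintro ⟨y, hy, rfl⟩
    exact hy
  · intro hx
    exact ⟨⟨x, h hx⟩, hx, rfl⟩

theorem subLE_comap_iff {S T V : L.Substructure N} (hS : S ≤ V) (hT : T ≤ V) :
    K.SubLE (S.comap V.subtype.toHom) (T.comap V.subtype.toHom) ↔ K.SubLE S T := by
  rw [← subLE_map_iff V.subtype, map_comap_subtype hS, map_comap_subtype hT]

theorem mod_comap_iff {S V : L.Substructure N} (hS : S ≤ V) :
    K.Mod (S.comap V.subtype.toHom) ↔ K.Mod S := by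
  have h := subLE_comap_iff (K := K) hS hS
  exact ⟨fun h' => (SubLE.mod (h.1 (SubLE.refl h'))).1, fun h' => (SubLE.mod (h.2 (SubLE.refl h'))).1⟩

theorem comap_subtype_iSup {ι : Sort*} {S : ι → L.Substructure N} {V : L.Substructure N}
    (h : ∀ i, S i ≤ V) :
    (⨆ i, S i).comap V.subtype.toHom = ⨆ i, (S i).comap V.subtype.toHom := by
  refine Substructure.map_injective_of_injective (f := V.subtype.toHom) V.subtype.injective ?_
  rw [map_comap_subtype (iSup_le h), Substructure.map_iSup]
  exact iSup_congr fun i => (map_comap_subtype (h i)).symm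

/-- The upper bound clause of the chain axiom, for bounds that are substructures. -/
theorem iSup_subLE_of_chain {ι : Type u} [LinearOrder ι] [WellFoundedLT ι] [Nonempty ι]
    (S : ι → L.Substructure N) (hmono : ∀ i j, i ≤ j → K.SubLE (S i) (S j))
    (hcont : ∀ i, Order.IsSuccLimit i → S i = ⨆ j : Set.Iio i, S j)
    {T : L.Substructure N} (hT : ∀ i, K.SubLE (S i) T) : K.SubLE (⨆ i, S i) T := by
  have hle : ∀ i, S i ≤ T := fun i => (hT i).1
  refine ⟨iSup_le hle, ?_⟩
  rw [comap_subtype_iSup hle]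
  -- The last clause of `union_chain` speaks of strength in the ambient structure, so the chain is
  -- moved into `T`, which becomes the ambient structure.
  refine (K.union_chain (fun i => (S i).comap T.subtype.toHom)
    (fun i => (mod_comap_iff (hle i)).2 (SubLE.mod (hT i)).1)
    (fun i j hij => (subLE_comap_iff (hle i) (hle j)).2 (hmono i j hij))
    (fun i hi => ?_)).2.2 (fun i => (hT i).2)
  rw [← comap_subtype_iSup fun j : Set.Iio i => hle j]
  exact congrArg _ (hcont i hi)

end Basic

end AEC

namespace AEC

open FirstOrder.Language

variable {L : FirstOrder.Language.{u, u}} {K : AEC L}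

/-! ### Directed unions from unions of chains -/

section Directed

variable {N : Type u} [L.Structure N]

/-- The supremum of the substructures indexed by the finite subsets of `W`. -/
def finsetSup {τ : Type u} (S : Finset τ → L.Substructure N) (W : Set τ) : L.Substructure N :=
  ⨆ A : {A : Finset τ // (A : Set τ) ⊆ W}, S A

theorem le_finsetSup {τ : Type u} (S : Finset τ → L.Substructure N) {W : Set τ} {A : Finset τ}
    (h : (A : Set τ) ⊆ W) : S A ≤ finsetSup S W :=
  le_iSup (fun A : {A : Finset τ // (A : Set τ) ⊆ W} => S A) ⟨A, h⟩

theorem finsetSup_mono {τ : Type u} (S : Finset τ → L.Substructure N) {W W' : Set τ}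
    (h : W ⊆ W') : finsetSup S W ≤ finsetSup S W' :=
  iSup_le fun A => le_finsetSup S (A.2.trans h)

theorem finsetSup_iUnion {τ ι : Type u} (S : Finset τ → L.Substructure N) {W : Set τ}
    {V : ι → Set τ} (hV : ∀ i, V i ⊆ W)
    (h : ∀ A : Finset τ, (A : Set τ) ⊆ W → ∃ i, (A : Set τ) ⊆ V i) :
    finsetSup S W = ⨆ i, finsetSup S (V i) := by
  refine le_antisymm (iSup_le fun A => ?_) (iSup_le fun i => finsetSup_mono S (hV i))
  obtain ⟨i, hi⟩ := h A A.2
  exact (le_finsetSup S hi).trans (le_iSup (fun i => finsetSup S (V i)) i)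

/-- Used with `s` a limit initial segment, for continuity of a chain, and with `s` everything, for
its exhaustion. -/
theorem exists_subset_image_Iio {ι : Type u} [LinearOrder ι] {τ : Type u} (f : ι → τ)
    {s : Set ι} (hs : s.Nonempty) (hlim : ∀ i ∈ s, ∃ j ∈ s, i < j) (A : Finset τ)
    (hA : (A : Set τ) ⊆ f '' s) : ∃ i ∈ s, (A : Set τ) ⊆ f '' Set.Iio i := by
  classical
  induction A using Finset.induction with
  | empty =>
    obtain ⟨i, hi⟩ := hs
    exact ⟨i, hi, by simp⟩
  | insert a A _ ih =>
    rw [Finset.coe_insert, Set.insert_subset_iff] at hA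
    obtain ⟨i, hi, hAi⟩ := ih hA.2
    obtain ⟨k, hk, rfl⟩ := hA.1
    obtain ⟨l, hl, hkl⟩ := hlim k hk
    refine ⟨max i l, by rcases max_choice i l with h | h <;> rwa [h], ?_⟩
    rw [Finset.coe_insert, Set.insert_subset_iff]
    exact ⟨⟨k, lt_max_of_lt_right hkl, rfl⟩,
      hAi.trans (Set.image_mono (Set.Iio_subset_Iio (le_max_left _ _)))⟩

/-- Induction on `#W`. Indexing by finite sets makes the subsystem below any `W` directed. An
infinite `W` is enumerated in order type `(#W).ord`; its proper initial segments have smaller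
cardinality, and their suprema form a continuous chain. -/
theorem finsetSup_spec {τ : Type u} (S : Finset τ → L.Substructure N)
    (hS : ∀ A B : Finset τ, A ⊆ B → K.SubLE (S A) (S B)) (W : Set τ) :
    K.Mod (finsetSup S W) ∧
      (∀ A : Finset τ, (A : Set τ) ⊆ W → K.SubLE (S A) (finsetSup S W)) ∧
      ∀ T : L.Substructure N, (∀ A : Finset τ, (A : Set τ) ⊆ W → K.SubLE (S A) T) →
        K.SubLE (finsetSup S W) T := by
  induction hc : #W using WellFoundedLT.induction generalizing W with
  | ind c ih =>
  subst hc
  rcases W.finite_or_infinite with hW | hW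
  -- A finite `W` is itself the largest index.
  · have hsup : finsetSup S W = S hW.toFinset := by
      refine le_antisymm (iSup_le fun A => (hS _ _ fun x hx => ?_).1) (le_finsetSup S (by simp))
      exact hW.mem_toFinset.2 (A.2 hx)
    rw [hsup]
    refine ⟨(SubLE.mod (hS _ _ (Finset.Subset.refl _))).1, fun A hA => hS _ _ fun x hx => ?_,
      fun T hT => hT _ (by simp)⟩
    exact hW.mem_toFinset.2 (hA hx)
  · have hinf : ℵ₀ ≤ #W := Cardinal.aleph0_le_mk_iff.2 hW.to_subtype
    let ι := (#W).ord.ToType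
    have hcard : #ι = #W := Cardinal.mk_ord_toType _
    obtain ⟨e⟩ := Cardinal.eq.1 hcard
    have : NoMaxOrder ι := Cardinal.noMaxOrder hinf
    have : Nonempty ι := ⟨e.symm ⟨_, hW.nonempty.some_mem⟩⟩
    let f : ι → τ := fun i => e i
    let V : ι → Set τ := fun i => f '' Set.Iio i
    have hVW : ∀ i, V i ⊆ W := by
      rintro i _ ⟨j, -, rfl⟩
      exact (e j).2
    have hfW : f '' Set.univ = W := by
      ext x
      constructor
      · rintro ⟨j, -, rfl⟩
        exact (e j).2
      · intro hx
        exact ⟨e.symm ⟨x, hx⟩, trivial, by simp [f]⟩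
    have hVlt : ∀ i, #(V i) < #W := fun i =>
      Cardinal.mk_image_le.trans_lt (by simpa [hcard] using Cardinal.mk_Iio_lt i (by simp [hcard, ι]))
    have ihV := fun i => ih _ (hVlt i) (V i) rfl
    have hVmono : ∀ i j, i ≤ j → V i ⊆ V j := fun i j hij =>
      Set.image_mono (Set.Iio_subset_Iio hij)
    have hmono : ∀ i j, i ≤ j → K.SubLE (finsetSup S (V i)) (finsetSup S (V j)) :=
      fun i j hij => (ihV i).2.2 _ fun A hA => (ihV j).2.1 A (hA.trans (hVmono i j hij))
    have hcont : ∀ i, Order.IsSuccLimit i →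
        finsetSup S (V i) = ⨆ j : Set.Iio i, finsetSup S (V j) := by
      intro i hi
      refine finsetSup_iUnion S (fun j => hVmono _ _ j.2.le) fun A hA => ?_
      obtain ⟨j, hj, hAj⟩ := exists_subset_image_Iio f (s := Set.Iio i)
        (not_isMin_iff.1 hi.1) (fun k hk => hi.lt_iff_exists_lt.1 hk) A hA
      exact ⟨⟨j, hj⟩, hAj⟩
    have hbound : ∀ A : Finset τ, (A : Set τ) ⊆ W → ∃ i, (A : Set τ) ⊆ V i := by
      intro A hA
      obtain ⟨i, -, hi⟩ := exists_subset_image_Iio f (s := Set.univ) Set.univ_nonempty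
        (fun k _ => (exists_gt k).imp fun _ h => ⟨trivial, h⟩) A (hfW.symm ▸ hA)
      exact ⟨i, hi⟩
    have hsup : finsetSup S W = ⨆ i, finsetSup S (V i) := finsetSup_iUnion S hVW hbound
    have hchain := K.union_chain _ (fun i => (ihV i).1) hmono hcont
    rw [hsup]
    refine ⟨hchain.1, fun A hA => ?_, fun T hT => ?_⟩
    · obtain ⟨i, hi⟩ := hbound A hA
      exact SubLE.trans ((ihV i).2.1 A hi) (hchain.2.1 i)
    · exact iSup_subLE_of_chain _ hmono hcont fun i =>
        (ihV i).2.2 T fun A hA => hT A (hA.trans (hVW i))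

/-- By recursion on finite sets, `g s` is chosen above the elements of `s` and above `g t` for every
proper subset `t`. This reindexes a directed system by finite sets, as `finsetSup_spec` requires. -/
theorem exists_monotone_finset {ι : Type u} [Preorder ι] [IsDirectedOrder ι] [Nonempty ι] :
    ∃ g : Finset ι → ι, (∀ A B : Finset ι, A ⊆ B → g A ≤ g B) ∧ ∀ i, i ≤ g {i} := by
  classical
  have hub : ∀ (s : Finset ι) (ih : ∀ t ⊂ s, ι),
      ∃ b, (∀ i ∈ s, i ≤ b) ∧ ∀ t (h : t ⊂ s), ih t h ≤ b := by
    intro s ih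
    obtain ⟨b, hb⟩ := Finset.exists_le (s ∪ s.ssubsets.attach.image
      fun t : {t // t ∈ s.ssubsets} => ih t.1 (Finset.mem_ssubsets.1 t.2))
    refine ⟨b, fun i hi => hb i (Finset.mem_union_left _ hi), fun t ht =>
      hb _ (Finset.mem_union_right _ (Finset.mem_image.2
        ⟨⟨t, Finset.mem_ssubsets.2 ht⟩, Finset.mem_attach _ _, rfl⟩))⟩
  choose H hH hH' using hub
  have hg : ∀ s, Finset.strongInduction H s = H s fun t _ => Finset.strongInduction H t :=
    fun s => Finset.strongInduction_eq H s
  refine ⟨Finset.strongInduction H, fun A B hAB => ?_, fun i => ?_⟩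
  · rcases eq_or_ne A B with rfl | hne
    · exact le_rfl
    · rw [hg B]
      exact hH' B (fun t _ => Finset.strongInduction H t) A (hAB.ssubset_of_ne hne)
  · rw [hg]
    exact hH _ _ _ (Finset.mem_singleton_self i)

/-- Unions of directed systems: the chain axiom holds for directed families. -/
theorem iSup_directed {ι : Type u} [Preorder ι] [IsDirectedOrder ι] [Nonempty ι]
    (S : ι → L.Substructure N) (hS : ∀ i j, i ≤ j → K.SubLE (S i) (S j)) :
    K.Mod (⨆ i, S i : L.Substructure N) ∧ (∀ i, K.SubLE (S i) (⨆ i, S i)) ∧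
      ∀ T : L.Substructure N, (∀ i, K.SubLE (S i) T) → K.SubLE (⨆ i, S i) T := by
  obtain ⟨g, hg, hg'⟩ := exists_monotone_finset (ι := ι)
  have h := finsetSup_spec (K := K) (fun A => S (g A)) (fun A B hAB => hS _ _ (hg A B hAB))
    Set.univ
  have hsup : finsetSup (fun A => S (g A)) Set.univ = ⨆ i, S i :=
    le_antisymm (iSup_le fun A => le_iSup S _) (iSup_le fun i => (hS _ _ (hg' i)).1.trans
      (le_finsetSup (fun A => S (g A)) (Set.subset_univ _)))
  rw [hsup] at h
  exact ⟨h.1, fun i => SubLE.trans (hS _ _ (hg' i)) (h.2.1 {i} (Set.subset_univ _)),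
    fun T hT => h.2.2 T fun A _ => hT _⟩

end Directed

end AEC

/-! ### Complete ultraproducts and their internal substructures -/

section Ultraproduct

open FirstOrder.Language

variable {L : FirstOrder.Language.{u, u}} {α : Type u} (U : Ultrafilter α)

theorem Ultrafilter.exists_eventually_eq_of_card_lt {κ : Cardinal.{u}}
    [CardinalInterFilter (U : Filter α) κ] {β : Type u} (hβ : #β < κ) (f : α → β) :
    ∃ b, ∀ᶠ i in U, f i = b := by
  by_contra! h
  obtain ⟨i, hi⟩ := ((Filter.eventually_cardinal_forall hβ).2 h).exists
  exact hi _ rfl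

theorem card_functions_le (n : ℕ) : #(L.Functions n) ≤ L.card :=
  Cardinal.mk_le_of_injective (f := fun F => (Sum.inl ⟨n, F⟩ : L.Symbols)) fun F G h => by
    simpa using h

theorem card_relations_le (n : ℕ) : #(L.Relations n) ≤ L.card :=
  Cardinal.mk_le_of_injective (f := fun F => (Sum.inr ⟨n, F⟩ : L.Symbols)) fun F G h => by
    simpa using h

variable {N : α → Type u}

/-- The class of a function in an ultraproduct. -/
def toProduct (f : ∀ i, N i) : (U : Filter α).Product N := Quotient.mk _ f

/-- Evaluation at `i` of a chosen representative of an element of an ultraproduct. -/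
noncomputable def evalOut (i : α) (x : (U : Filter α).Product N) : N i := Quotient.out x i

theorem mk_eq_iff_eventually {f g : ∀ i, N i} :
    toProduct U f = toProduct U g ↔ ∀ᶠ i in U, f i = g i :=
  Quotient.eq

theorem mk_evalOut (x : (U : Filter α).Product N) :
    (toProduct U fun i => evalOut U i x) = x :=
  Quotient.out_eq x

theorem eventually_evalOut_mk (f : ∀ i, N i) :
    ∀ᶠ i in U, evalOut U i (toProduct U f) = f i :=
  (mk_eq_iff_eventually U).1 (mk_evalOut U _)

theorem eq_iff_eventually_evalOut {x y : (U : Filter α).Product N} :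
    x = y ↔ ∀ᶠ i in U, evalOut U i x = evalOut U i y := by
  rw [← mk_eq_iff_eventually, mk_evalOut, mk_evalOut]

variable [∀ i, L.Structure (N i)]

theorem eventually_evalOut_funMap {n : ℕ} (F : L.Functions n)
    (x : Fin n → (U : Filter α).Product N) :
    ∀ᶠ i in U, evalOut U i (Structure.funMap F x) =
      Structure.funMap F fun k => evalOut U i (x k) := by
  have h : Structure.funMap F (fun k => toProduct U fun i => evalOut U i (x k)) =
      toProduct U fun i => Structure.funMap F fun k => evalOut U i (x k) :=
    Ultraproduct.funMap_cast (u := U) F fun k i => evalOut U i (x k)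
  have h' : (fun k => toProduct U fun i => evalOut U i (x k)) = x :=
    funext fun k => mk_evalOut U (x k)
  rw [h'] at h
  rw [h]
  exact eventually_evalOut_mk U _

theorem relMap_iff_eventually_evalOut {n : ℕ} (R : L.Relations n)
    (x : Fin n → (U : Filter α).Product N) :
    Structure.RelMap R x ↔ ∀ᶠ i in U, Structure.RelMap R fun k => evalOut U i (x k) := by
  have h' : (fun k => toProduct U fun i => evalOut U i (x k)) = x :=
    funext fun k => mk_evalOut U (x k)
  conv_lhs => rw [← h']
  exact relMap_quotient_mk' ((U : Filter α).productSetoid N) R fun k i => evalOut U i (x k)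

/-- The internal substructure `∏ A i / U` of the ultraproduct `∏ N i / U`. -/
def internalSubstructure (A : ∀ i, L.Substructure (N i)) :
    L.Substructure ((U : Filter α).Product N) where
  carrier := {x | ∀ᶠ i in U, evalOut U i x ∈ A i}
  fun_mem := fun {n} F x hx => by
    have h : ∀ᶠ i in U, ∀ k, evalOut U i (x k) ∈ A i := Filter.eventually_all.2 hx
    filter_upwards [h, eventually_evalOut_funMap U F x] with i hi hF
    show evalOut U i (Structure.funMap F x) ∈ A i
    rw [hF]
    exact (A i).fun_mem F _ hi

variable {U}

theorem mem_internalSubstructure {A : ∀ i, L.Substructure (N i)}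
    {x : (U : Filter α).Product N} :
    x ∈ internalSubstructure U A ↔ ∀ᶠ i in U, evalOut U i x ∈ A i :=
  Iff.rfl

theorem mk_mem_internalSubstructure {A : ∀ i, L.Substructure (N i)} {f : ∀ i, N i} :
    (toProduct U f) ∈ internalSubstructure U A ↔
      ∀ᶠ i in U, f i ∈ A i := by
  refine Filter.eventually_congr ?_
  filter_upwards [eventually_evalOut_mk U f] with i hi
  rw [hi]

-- Code each `A i` in the fixed set `μ.out`. An element of the internal product becomes a function
-- into fewer than `κ` values, constant almost everywhere by completeness, and this constant
-- determines the element.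
variable (U) in
theorem card_internalSubstructure_le {κ μ : Cardinal.{u}} [CardinalInterFilter (U : Filter α) κ]
    (hμ : μ < κ) (A : ∀ i, L.Substructure (N i)) (hA : ∀ i, #(A i) ≤ μ) :
    #(internalSubstructure U A) ≤ μ := by
  classical
  rcases isEmpty_or_nonempty (internalSubstructure U A) with hE | ⟨⟨x₀, hx₀⟩⟩
  · simp
  obtain ⟨i₀, hi₀⟩ := (mem_internalSubstructure.1 hx₀).exists
  have hne : Nonempty μ.out := by
    rw [← Cardinal.mk_ne_zero_iff, Cardinal.mk_out]
    have : 0 < #(A i₀) := pos_iff_ne_zero.2 (Cardinal.mk_ne_zero_iff.2 ⟨⟨_, hi₀⟩⟩)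
    exact (this.trans_le (hA i₀)).ne'
  have hemb : ∀ i, ∃ g : A i → μ.out, Function.Injective g := fun i => by
    have h := hA i
    rw [← Cardinal.mk_out μ, Cardinal.le_def] at h
    exact ⟨h.some, h.some.injective⟩
  choose g hg using hemb
  -- The default value is taken only on a null set of indices, as `x` lies in the internal product.
  have hconst : ∀ x : internalSubstructure U A, ∃ c : μ.out, ∀ᶠ i in U,
      (if h : evalOut U i x.1 ∈ A i then g i ⟨_, h⟩ else Classical.arbitrary _) = c :=
    fun x => U.exists_eventually_eq_of_card_lt (κ := κ) (by rwa [Cardinal.mk_out]) _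
  choose c hc using hconst
  rw [← Cardinal.mk_out μ]
  refine Cardinal.mk_le_of_injective (f := c) fun x y hxy => Subtype.ext ?_
  rw [eq_iff_eventually_evalOut]
  filter_upwards [hc x, hc y, x.2, y.2] with i h1 h2 h3 h4
  have h3' : evalOut U i x.1 ∈ A i := h3
  have h4' : evalOut U i y.1 ∈ A i := h4
  rw [dif_pos h3'] at h1
  rw [dif_pos h4'] at h2
  exact congrArg Subtype.val (hg i (h1.trans (hxy.trans h2.symm)))

variable (U) in
/-- A small internal substructure is isomorphic to almost every factor, through evaluation. -/
theorem eventually_exists_equiv_internalSubstructure [∀ i, Nonempty (N i)]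
    {κ μ : Cardinal.{u}} [CardinalInterFilter (U : Filter α) κ] (hκ : ℵ₀ < κ) (hL : L.card < κ) (hμ : μ < κ)
    (A : ∀ i, L.Substructure (N i)) (hA : ∀ i, #(A i) ≤ μ) :
    ∀ᶠ i in U, ∃ φ : internalSubstructure U A ≃[L] A i, ∀ x, (φ x : N i) = evalOut U i x.1 := by
  have hcard : #(internalSubstructure U A) < κ :=
    (card_internalSubstructure_le U hμ A hA).trans_lt hμ
  have hpow : ∀ n : ℕ, #(Fin n → internalSubstructure U A) < κ := fun n => by
    rw [Cardinal.mk_pi, Cardinal.prod_const, Cardinal.mk_fin]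
    simp only [Cardinal.lift_uzero, Cardinal.lift_natCast, Cardinal.power_natCast]
    rcases lt_or_ge #(internalSubstructure U A) ℵ₀ with h | h
    · exact (Cardinal.power_lt_aleph0 h (Cardinal.natCast_lt_aleph0 (n := n))).trans hκ
    · exact (Cardinal.power_nat_le h).trans_lt hcard
  have hnat : #(ULift.{u} ℕ) < κ := by simpa using hκ
  have hmem : ∀ᶠ i in U, ∀ x : internalSubstructure U A, evalOut U i x.1 ∈ A i :=
    (Filter.eventually_cardinal_forall hcard).2 fun x => x.2
  have hinj : ∀ᶠ i in U, ∀ x y : internalSubstructure U A,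
      evalOut U i x.1 = evalOut U i y.1 → x = y := by
    refine (Filter.eventually_cardinal_forall hcard).2 fun x =>
      (Filter.eventually_cardinal_forall hcard).2 fun y => ?_
    by_cases hxy : x = y
    · exact Filter.Eventually.of_forall fun _ _ => hxy
    · have : ¬ ∀ᶠ i in U, evalOut U i x.1 = evalOut U i y.1 := fun h =>
        hxy (Subtype.ext ((eq_iff_eventually_evalOut U).2 h))
      filter_upwards [Ultrafilter.eventually_not.2 this] with i hi h
      exact absurd h hi
  have hsurj : ∀ᶠ i in U, ∀ y ∈ A i, ∃ x : internalSubstructure U A, evalOut U i x.1 = y := by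
    by_contra hcon
    rw [← Ultrafilter.eventually_not] at hcon
    -- If surjectivity failed almost everywhere, missed points would assemble into an element of the
    -- internal product, whose evaluations hit them almost everywhere.
    let Q : ∀ i, N i → Prop := fun i y =>
      y ∈ A i ∧ ∀ x : internalSubstructure U A, evalOut U i x.1 ≠ y
    let f : ∀ i, N i := fun i => Classical.epsilon (Q i)
    have hf : ∀ᶠ i in U, Q i (f i) := by
      filter_upwards [hcon] with i hi
      push Not at hi
      exact Classical.epsilon_spec hi
    have hfmem : toProduct U f ∈ internalSubstructure U A :=
      mk_mem_internalSubstructure.2 (hf.mono fun i hi => hi.1)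
    obtain ⟨i, hi, hi'⟩ := (hf.and (eventually_evalOut_mk U f)).exists
    exact hi.2 ⟨_, hfmem⟩ hi'
  have hfun : ∀ᶠ i in U, ∀ (n : ULift.{u} ℕ) (F : L.Functions n.down)
      (x : Fin n.down → internalSubstructure U A),
      evalOut U i (Structure.funMap F fun k => (x k).1) =
        Structure.funMap F fun k => evalOut U i (x k).1 :=
    (Filter.eventually_cardinal_forall hnat).2 fun n =>
      (Filter.eventually_cardinal_forall ((card_functions_le n.down).trans_lt hL)).2 fun F =>
        (Filter.eventually_cardinal_forall (hpow n.down)).2 fun x =>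
          eventually_evalOut_funMap U F _
  have hrel : ∀ᶠ i in U, ∀ (n : ULift.{u} ℕ) (R : L.Relations n.down)
      (x : Fin n.down → internalSubstructure U A),
      Structure.RelMap R (fun k => evalOut U i (x k).1) ↔
        Structure.RelMap R fun k => (x k).1 := by
    refine (Filter.eventually_cardinal_forall hnat).2 fun n =>
      (Filter.eventually_cardinal_forall ((card_relations_le n.down).trans_lt hL)).2 fun R =>
        (Filter.eventually_cardinal_forall (hpow n.down)).2 fun x => ?_
    have h := relMap_iff_eventually_evalOut U R fun k => (x k).1
    by_cases hR : Structure.RelMap R fun k => (x k).1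
    · exact (h.1 hR).mono fun i hi => iff_of_true hi hR
    · exact (Ultrafilter.eventually_not.2 (mt h.2 hR)).mono fun i hi => iff_of_false hi hR
  filter_upwards [hmem, hinj, hsurj, hfun, hrel] with i h1 h2 h3 h4 h5
  refine ⟨{ Equiv.ofBijective (fun x : internalSubstructure U A => (⟨evalOut U i x.1, h1 x⟩ : A i))
      ⟨fun x y hxy => h2 x y (congrArg Subtype.val hxy), fun y => ?_⟩ with
    map_fun' := fun {n} F x => Subtype.ext (h4 ⟨n⟩ F x)
    map_rel' := fun {n} R x => h5 ⟨n⟩ R x }, fun x => rfl⟩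
  obtain ⟨x, hx⟩ := h3 y y.2
  exact ⟨x, Subtype.ext hx⟩

end Ultraproduct

namespace AEC

open FirstOrder.Language

variable {L : FirstOrder.Language.{u, u}} {K : AEC L}

/-! ### Small strong submodels -/

section LoewenheimSkolem

theorem isLSBound_LS (K : AEC L) : K.IsLSBound K.LS :=
  csInf_mem (s := {lam | K.IsLSBound lam}) K.exists_isLSBound

theorem aleph0_le_LS (K : AEC L) : ℵ₀ ≤ K.LS :=
  le_add_self.trans K.isLSBound_LS.1

theorem card_le_LS (K : AEC L) : L.card ≤ K.LS :=
  le_self_add.trans K.isLSBound_LS.1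

theorem exists_strong_superset {N : Type u} [L.Structure N] (hN : K.Mod N) {μ : Cardinal.{u}}
    (hμ : K.LS ≤ μ) {A : Set N} (hA : #A ≤ μ) :
    ∃ S : L.Substructure N, K.Strong S ∧ A ⊆ (S : Set N) ∧ #S ≤ μ := by
  obtain ⟨S, hS, hAS, hcard⟩ := K.isLSBound_LS.2 N hN A
  exact ⟨S, hS, hAS, hcard.trans (Cardinal.add_le_of_le (K.aleph0_le_LS.trans hμ) hA hμ)⟩

/-- The small strong submodels of a model. -/
abbrev SmallStrong (K : AEC L) (N : Type u) [L.Structure N] (μ : Cardinal.{u}) : Type u :=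
  {S : L.Substructure N // K.Strong S ∧ #S ≤ μ}

theorem exists_strong_superset_pair {N : Type u} [L.Structure N] (hN : K.Mod N)
    {μ : Cardinal.{u}} (hμ : K.LS ≤ μ) {S T : L.Substructure N} (hS : #S ≤ μ) (hT : #T ≤ μ) :
    ∃ V : L.Substructure N, K.Strong V ∧ #V ≤ μ ∧ S ≤ V ∧ T ≤ V := by
  have hcard : #((S : Set N) ∪ T : Set N) ≤ μ := (Cardinal.mk_union_le _ _).trans
    (Cardinal.add_le_of_le (K.aleph0_le_LS.trans hμ) hS hT)
  obtain ⟨V, hV, hle, hVc⟩ := exists_strong_superset hN hμ hcard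
  exact ⟨V, hV, hVc, Set.subset_union_left.trans hle, Set.subset_union_right.trans hle⟩

end LoewenheimSkolem

/-! ### Łoś's theorem for models, embeddings and small types -/

section Ultraproduct

variable {α : Type u} (U : Ultrafilter α) {N : α → Type u} [∀ i, L.Structure (N i)]
  [∀ i, Nonempty (N i)] {κ μ : Cardinal.{u}} [CardinalInterFilter (U : Filter α) κ]

theorem subLE_internalSubstructure (hLS : K.LS < κ) (hμ : μ < κ)
    {A B : ∀ i, L.Substructure (N i)} (hB : ∀ i, #(B i) ≤ μ) (h : ∀ i, K.SubLE (A i) (B i)) :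
    K.SubLE (internalSubstructure U A) (internalSubstructure U B) := by
  refine ⟨fun x hx => (mem_internalSubstructure.1 hx).mono fun i hi => (h i).1 hi, ?_⟩
  have h1 := eventually_exists_equiv_internalSubstructure U (K.aleph0_le_LS.trans_lt hLS)
    (K.card_le_LS.trans_lt hLS) hμ B hB
  have hcard := (card_internalSubstructure_le U hμ B hB).trans_lt hμ
  have h2 : ∀ᶠ i in U, ∀ x : internalSubstructure U B,
      evalOut U i x.1 ∈ A i ↔ x.1 ∈ internalSubstructure U A := by
    refine (Filter.eventually_cardinal_forall hcard).2 fun x => ?_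
    by_cases hx : x.1 ∈ internalSubstructure U A
    · exact (mem_internalSubstructure.1 hx).mono fun i hi => iff_of_true hi hx
    · exact (Ultrafilter.eventually_not.2 hx).mono fun i hi => iff_of_false hi hx
  -- One good index suffices: `φ` matches both internal products with `A i` and `B i`, and strength
  -- is pulled back along it.
  obtain ⟨i, ⟨φ, hφ⟩, hi⟩ := (h1.and h2).exists
  convert K.strong_iso φ.symm (h i).2 using 1
  ext x
  constructor
  · intro hx
    refine ⟨φ x, ?_, φ.symm_apply_apply x⟩
    show (φ x : N i) ∈ A i
    rw [hφ]
    exact (hi x).2 hx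
  · rintro ⟨y, hy, rfl⟩
    have hy' : (y : N i) ∈ A i := hy
    have := hφ (φ.symm y)
    rw [φ.apply_symm_apply] at this
    rw [this] at hy'
    exact (hi _).1 hy'

/-- Łoś's theorem for an abstract elementary class: it is closed under sufficiently complete
ultraproducts, in which internal small strong submodels are strong. -/
theorem mod_ultraproduct (hLSμ : K.LS ≤ μ) (hμ : μ < κ) (hN : ∀ i, K.Mod (N i)) :
    K.Mod ((U : Filter α).Product N) ∧ ∀ A : ∀ i, L.Substructure (N i),
      (∀ i, K.Strong (A i)) → (∀ i, #(A i) ≤ μ) → K.Strong (internalSubstructure U A) := by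
  -- These families are directed pointwise, and their internal products cover the ultraproduct.
  let ι := {A : ∀ i, L.Substructure (N i) // ∀ i, K.Strong (A i) ∧ #(A i) ≤ μ}
  have hdir : IsDirectedOrder ι := ⟨fun A B => by
    choose V hV using fun i => exists_strong_superset_pair (hN i) hLSμ (A.2 i).2 (B.2 i).2
    exact ⟨⟨V, fun i => ⟨(hV i).1, (hV i).2.1⟩⟩, fun i => (hV i).2.2.1, fun i => (hV i).2.2.2⟩⟩
  have hex : ∀ f : ∀ i, N i, ∃ A : ι, ∀ i, f i ∈ A.1 i := fun f => by
    choose V hV using fun i => exists_strong_superset (hN i) hLSμ (A := {f i}) (by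
      rw [Cardinal.mk_singleton]
      exact Cardinal.one_le_aleph0.trans (K.aleph0_le_LS.trans hLSμ))
    exact ⟨⟨V, fun i => ⟨(hV i).1, (hV i).2.2⟩⟩, fun i => (hV i).2.1 rfl⟩
  have hne : Nonempty ι := ⟨(hex fun i => Classical.arbitrary _).choose⟩
  have h := iSup_directed (K := K) (fun A : ι => internalSubstructure U A.1) fun A B hAB =>
    subLE_internalSubstructure U (hLSμ.trans_lt hμ) hμ (fun i => (B.2 i).2)
      fun i => K.coherence (A.2 i).1 (B.2 i).1 (hAB i)
  have htop : (⨆ A : ι, internalSubstructure U A.1) = ⊤ := by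
    refine eq_top_iff.2 fun x _ => ?_
    obtain ⟨A, hA⟩ := hex fun i => evalOut U i x
    exact le_iSup (fun A : ι => internalSubstructure U A.1) A
      (mem_internalSubstructure.2 (Filter.Eventually.of_forall hA))
  rw [htop] at h
  exact ⟨K.mod_iso Substructure.topEquiv h.1,
    fun A hA hA' => subLE_top_iff.1 (h.2.1 ⟨A, fun i => ⟨hA i, hA' i⟩⟩)⟩

variable {M : Type u} [L.Structure M]

/-- The diagonal embedding induced by a family of embeddings. -/
def diagonal (e : ∀ i, M ↪[L] N i) : M ↪[L] (U : Filter α).Product N where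
  toFun m := toProduct U fun i => e i m
  inj' x y hxy := by
    obtain ⟨i, hi⟩ := ((mk_eq_iff_eventually U).1 hxy).exists
    exact (e i).injective hi
  map_fun' F x := by
    have h : Structure.funMap F (fun k => toProduct U fun i => e i (x k)) =
        toProduct U fun i => Structure.funMap F fun k => e i (x k) :=
      Ultraproduct.funMap_cast (u := U) F fun k i => e i (x k)
    refine Eq.trans ?_ h.symm
    exact congrArg _ (funext fun i => (e i).map_fun F x)
  map_rel' R x := by
    refine (relMap_quotient_mk' ((U : Filter α).productSetoid N) R fun k i => e i (x k)).trans ?_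
    refine Iff.trans (Filter.eventually_congr (Filter.Eventually.of_forall fun i =>
      (e i).map_rel R x)) ?_
    simp

/-- For a small strong `S` in `M`, the diagonal image of `S` is the whole internal product of the `e
i` images: an element of that product gives a function into `S`, constant almost everywhere. The
range of the diagonal is the directed union of these strong images. -/
theorem isEmb_diagonal (hLS : K.LS < κ) (e : ∀ i, M ↪[L] N i) (he : ∀ i, K.IsEmb (e i)) :
    K.IsEmb (diagonal U e) := by
  obtain ⟨i₀⟩ : Nonempty α := U.neBot.nonempty
  have hM : K.Mod M := (he i₀).mod_left
  obtain ⟨-, hstrong⟩ := mod_ultraproduct (K := K) U le_rfl hLS fun i => (he i).mod_right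
  have himage : ∀ S : K.SmallStrong M K.LS, K.Strong (S.1.map (diagonal U e).toHom) := by
    intro S
    convert hstrong (fun i => S.1.map (e i).toHom) (fun i => ?_) fun i => ?_ using 1
    · ext x
      rw [mem_internalSubstructure]
      constructor
      · rintro ⟨m, hm, rfl⟩
        filter_upwards [eventually_evalOut_mk U fun i => e i m] with i hi
        exact ⟨m, hm, hi.symm⟩
      · intro hx
        obtain ⟨i₁, m₁, hm₁, -⟩ := hx.exists
        -- Where `x` does not evaluate into the image, `m₁` serves as a default; such indices form a
        -- null set.
        have : ∀ i, ∃ m : S.1, (∃ m ∈ S.1, e i m = evalOut U i x) → e i m = evalOut U i x :=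
          fun i => by
            by_cases h : ∃ m ∈ S.1, e i m = evalOut U i x
            · obtain ⟨m, hm, hmx⟩ := h
              exact ⟨⟨m, hm⟩, fun _ => hmx⟩
            · exact ⟨⟨m₁, hm₁⟩, fun h' => absurd h' h⟩
        choose s hs using this
        obtain ⟨m, hm⟩ := U.exists_eventually_eq_of_card_lt (κ := κ) (S.2.2.trans_lt hLS) s
        refine ⟨m, m.2, ?_⟩
        refine Eq.trans ?_ (mk_evalOut U x)
        refine (mk_eq_iff_eventually U).2 ?_
        filter_upwards [hx, hm] with i hi hmi
        rw [← hmi]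
        exact hs i hi
    · have hr : S.1.map (e i).toHom = ((e i).comp S.1.subtype).toHom.range := by
        ext x
        constructor
        · rintro ⟨m, hm, rfl⟩
          exact ⟨⟨m, hm⟩, rfl⟩
        · rintro ⟨m, rfl⟩
          exact ⟨m, m.2, rfl⟩
      rw [hr]
      exact (he i).comp (isEmb_subtype S.2.1)
    · refine le_trans ?_ S.2.2
      exact (Cardinal.mk_congr ((e i).substructureEquivMap S.1).toEquiv).ge
  have hdir : IsDirectedOrder (K.SmallStrong M K.LS) := ⟨fun S T => by
    obtain ⟨V, h1, h2, h3⟩ := exists_strong_superset_pair hM le_rfl S.2.2 T.2.2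
    exact ⟨⟨V, h1, h2⟩, h3⟩⟩
  have hex : ∀ m : M, ∃ S : K.SmallStrong M K.LS, m ∈ S.1 := fun m => by
    obtain ⟨S, h1, h2, h3⟩ := exists_strong_superset hM le_rfl (A := {m}) (by
      rw [Cardinal.mk_singleton]
      exact Cardinal.one_le_aleph0.trans K.aleph0_le_LS)
    exact ⟨⟨S, h1, h3⟩, h2 rfl⟩
  have hne : Nonempty (K.SmallStrong M K.LS) := by
    obtain ⟨S, h1, -, h3⟩ := exists_strong_superset hM le_rfl (A := ∅) (by simp)
    exact ⟨⟨S, h1, h3⟩⟩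
  have h := (iSup_directed (K := K)
    (fun S : K.SmallStrong M K.LS => S.1.map (diagonal U e).toHom) fun S T hST =>
      K.coherence (himage S) (himage T) (Substructure.monotone_map hST)).2.2 ⊤
      fun S => subLE_top_iff.2 (himage S)
  have hrange : (⨆ S : K.SmallStrong M K.LS, S.1.map (diagonal U e).toHom) =
      (diagonal U e).toHom.range := by
    rw [← Substructure.map_iSup, Hom.range_eq_map]
    congr 1
    refine eq_top_iff.2 fun m _ => ?_
    obtain ⟨S, hS⟩ := hex m
    exact le_iSup (fun S : K.SmallStrong M K.LS => S.1) S hS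
  rw [hrange] at h
  exact subLE_top_iff.1 h

theorem tp_congr {J N' : Type u} [L.Structure N'] {e e' : M ↪[L] N'} {he : K.IsEmb e}
    {he' : K.IsEmb e'} {a a' : J → N'} (h : e = e') (ha : a = a') : tp e he a = tp e' he' a' := by
  subst h ha
  rfl

/-- A single `AT` step, with `P` itself as the amalgam. -/
theorem tp_comp {J N' P : Type u} [L.Structure N'] [L.Structure P] {e : M ↪[L] N'}
    (he : K.IsEmb e) (a : J → N') {f : N' ↪[L] P} (hf : K.IsEmb f) :
    tp (f.comp e) (hf.comp he) (f ∘ a) = tp e he a :=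
  Quotient.sound (.single ⟨P, inferInstance, .refl L P, f, IsEmb.refl hf.mod_right, hf,
    fun _ => rfl, fun _ => rfl⟩)

/-- The small types realized in an ultraproduct are those realized in almost every factor. -/
theorem eventually_realizedBy_iff {I : Type u} (hLS : K.LS < κ) (e : ∀ i, M ↪[L] N i)
    (he : ∀ i, K.IsEmb (e i)) (a : ∀ i, I → N i) (p : K.SmallType M κ I) :
    ∀ᶠ i in U, (p.RealizedBy (e i) (he i) (a i) ↔
      p.RealizedBy (diagonal U e) (isEmb_diagonal U hLS e he)
        fun j => toProduct U fun i => a i j) := by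
  let ν : Cardinal.{u} := #p.dom + #p.length + K.LS
  have hκ : ℵ₀ ≤ κ := K.aleph0_le_LS.trans hLS.le
  have hν : ν < κ := Cardinal.add_lt_of_lt hκ
    (Cardinal.add_lt_of_lt hκ p.dom_lt p.length_lt) hLS
  have hLSν : K.LS ≤ ν := le_add_self
  have hex : ∀ i, ∃ A : L.Substructure (N i), K.Strong A ∧
      (e i '' p.dom ∪ a i '' p.length) ⊆ (A : Set (N i)) ∧ #A ≤ ν := fun i =>
    exists_strong_superset (he i).mod_right hLSν <| (Cardinal.mk_union_le _ _).trans <|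
      (add_le_add Cardinal.mk_image_le Cardinal.mk_image_le).trans le_self_add
  choose A hA hsub hcard using hex
  have hAU := (mod_ultraproduct (K := K) U hLSν hν fun i => (he i).mod_right).2 A hA hcard
  have hdom : ∀ m : p.dom, diagonal U e m ∈ internalSubstructure U A := fun m =>
    mk_mem_internalSubstructure.2 (Filter.Eventually.of_forall fun i =>
      hsub i (Or.inl ⟨m, m.2, rfl⟩))
  have hseq : ∀ j : p.length, (toProduct U fun i => a i j) ∈ internalSubstructure U A := fun j =>
    mk_mem_internalSubstructure.2 (Filter.Eventually.of_forall fun i =>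
      hsub i (Or.inr ⟨j, j.2, rfl⟩))
  -- The type of `b` over `d` in the small internal product is the common value: it passes up to the
  -- ultraproduct by inclusion, and to almost every factor by evaluation.
  let d : p.dom ↪[L] internalSubstructure U A :=
    Embedding.codRestrict (internalSubstructure U A) ((diagonal U e).comp p.dom.subtype) hdom
  let b : p.length → internalSubstructure U A := fun j => ⟨_, hseq j⟩
  have hd : K.IsEmb d := IsEmb.of_comp (g := (internalSubstructure U A).subtype)
    ((isEmb_diagonal U hLS e he).comp (isEmb_subtype p.strong_dom)) (isEmb_subtype hAU)
  have h1 : tp ((diagonal U e).comp p.dom.subtype)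
      ((isEmb_diagonal U hLS e he).comp (isEmb_subtype p.strong_dom))
      (fun j : p.length => toProduct U fun i => a i j) = tp d hd b :=
    tp_comp hd b (isEmb_subtype hAU)
  have hev := eventually_exists_equiv_internalSubstructure U
    (K.aleph0_le_LS.trans_lt hLS) (K.card_le_LS.trans_lt hLS) hν A hcard
  have hevd : ∀ᶠ i in U, ∀ m : p.dom, evalOut U i (diagonal U e m) = e i m :=
    (Filter.eventually_cardinal_forall p.dom_lt).2 fun m => eventually_evalOut_mk U _
  have hevb : ∀ᶠ i in U, ∀ j : p.length, evalOut U i (toProduct U fun i => a i j) = a i j :=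
    (Filter.eventually_cardinal_forall p.length_lt).2 fun j => eventually_evalOut_mk U _
  filter_upwards [hev, hevd, hevb] with i ⟨φ, hφ⟩ h2 h3
  have hf : K.IsEmb ((A i).subtype.comp φ.toEmbedding) :=
    (isEmb_subtype (hA i)).comp (isEmb_equiv φ (K.mod_of_strong hAU).1)
  have h4 : tp ((e i).comp p.dom.subtype) ((he i).comp (isEmb_subtype p.strong_dom))
      (fun j : p.length => a i j) = tp d hd b := by
    rw [← tp_comp hd b hf]
    refine tp_congr (Embedding.ext fun m => ?_) (funext fun j => ?_)
    · exact ((hφ _).trans (h2 m)).symm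
    · exact ((hφ _).trans (h3 j)).symm
  unfold SmallType.RealizedBy
  rw [h1, h4]

end Ultraproduct

end AEC

/-! ### Regularity and fine ultrafilters -/

section StronglyCompact

/-- A filter that is complete for a singular cardinal is closed under intersections of that many
sets. -/
theorem Cardinal.IsSingular.eventually_forall {κ : Cardinal.{u}} (hκ : κ.IsSingular) {α : Type u}
    {l : Filter α} [CardinalInterFilter l κ] {p : α → κ.ord.ToType → Prop}
    (h : ∀ i, ∀ᶠ x in l, p x i) : ∀ᶠ x in l, ∀ i, p x i := by
  have : NoMaxOrder κ.ord.ToType := Cardinal.noMaxOrder hκ.aleph0_le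
  -- Singularity writes `κ` as a union of fewer than `κ` initial segments, each smaller than `κ`, so
  -- completeness is applied twice.
  obtain ⟨s, hs, hcard⟩ := Order.exists_cof_eq κ.ord.ToType
  have hsκ : #s < κ := by
    rw [hcard, Ordinal.cof_toType]
    exact hκ.cof_ord_lt
  have h1 : ∀ᶠ x in l, ∀ (j : s) (i : Set.Iio j.1), p x i :=
    (Filter.eventually_cardinal_forall hsκ).2 fun j =>
      (Filter.eventually_cardinal_forall (by simpa using Cardinal.mk_Iio_lt j.1 (by simp))).2
        fun i => h i
  filter_upwards [h1] with x hx i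
  obtain ⟨k, hk⟩ := exists_gt i
  obtain ⟨j, hj, hkj⟩ := hs k
  exact hx ⟨j, hj⟩ ⟨i, hk.trans_le hkj⟩

/-- If `κ` were singular, a `κ`-complete ultrafilter on `2^κ` extending the filter of sets with
complement of size at most `κ` would also decide all `κ` coordinates at once. It would then
concentrate on one point, whose complement it contains. -/
theorem IsStronglyCompact.isRegular {κ : Cardinal.{u}} (hκ : IsStronglyCompact κ) :
    κ.IsRegular := by
  refine Cardinal.IsRegular.of_not_isSingular hκ.1.le fun hsing => ?_
  have hreg : (Order.succ κ).IsRegular := Cardinal.isRegular_succ hκ.1.le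
  let α : Type u := κ.ord.ToType → Prop
  have hα : Order.succ κ ≤ #α := by
    rw [Order.succ_le_iff]
    simpa [α] using Cardinal.cantor κ
  have hne : (Filter.cocardinal α hreg).NeBot := by
    refine ⟨fun h => ?_⟩
    have h' := Filter.empty_mem_iff_bot.2 h
    rw [Filter.mem_cocardinal, Set.compl_empty, Cardinal.mk_univ] at h'
    exact h'.not_ge hα
  obtain ⟨U, hU, hUκ⟩ := hκ.2 α (Filter.cocardinal α hreg) hne
    (CardinalInterFilter.of_cardinalInterFilter_of_le _ (Order.le_succ κ))
  let b : α := fun i => ∀ᶠ x : α in U, x i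
  have hb : ∀ᶠ x : α in U, ∀ i, (x i ↔ b i) := by
    refine hsing.eventually_forall fun i => ?_
    by_cases hi : ∀ᶠ x : α in U, x i
    · exact hi.mono fun x hx => iff_of_true hx hi
    · exact (Ultrafilter.eventually_not.2 hi).mono fun x hx => iff_of_false hx hi
  have hb' : ({b}ᶜ : Set α) ∈ U := by
    refine hU ?_
    rw [Filter.mem_cocardinal, compl_compl, Cardinal.mk_singleton]
    exact Cardinal.one_lt_aleph0.trans_le hreg.aleph0_le
  obtain ⟨x, hx, hx'⟩ := (hb.and hb').exists
  exact hx' (funext fun i => propext (hx i))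

/-- Over a strongly compact cardinal `κ` there are fine `κ`-complete ultrafilters on `P_κ B`. -/
theorem IsStronglyCompact.exists_fine {κ : Cardinal.{u}} (hκ : IsStronglyCompact κ) (B : Type u) :
    ∃ U : Ultrafilter {Z : Set B // #Z < κ},
      CardinalInterFilter (U : Filter {Z : Set B // #Z < κ}) κ ∧
      ∀ b, ∀ᶠ Z in (U : Filter {Z : Set B // #Z < κ}), b ∈ Z.1 := by
  have hreg := hκ.isRegular
  have hdir : IsDirectedOrder {Z : Set B // #Z < κ} := ⟨fun Z W =>
    ⟨⟨Z.1 ∪ W.1, (Cardinal.mk_union_le _ _).trans_lt (Cardinal.add_lt_of_lt hκ.1.le Z.2 W.2)⟩,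
      Set.subset_union_left, Set.subset_union_right⟩⟩
  have hne : Nonempty {Z : Set B // #Z < κ} := ⟨⟨∅, by simpa using hreg.pos⟩⟩
  have hcomplete : CardinalInterFilter (Filter.atTop : Filter {Z : Set B // #Z < κ}) κ := by
    refine ⟨fun S hS hmem => ?_⟩
    choose Z hZ using fun s : S => Filter.mem_atTop_sets.1 (hmem s.1 s.2)
    -- Regularity is what keeps this union in `P_κ B`.
    have hcard : #(⋃ s, (Z s).1 : Set B) < κ :=
      (Cardinal.card_iUnion_lt_iff_forall_of_isRegular hreg hS).2 fun s => (Z s).2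
    refine Filter.mem_atTop_sets.2 ⟨⟨_, hcard⟩, fun W hW s hs => hZ ⟨s, hs⟩ W ?_⟩
    exact (Set.subset_iUnion (fun s => (Z s).1) ⟨s, hs⟩).trans hW
  obtain ⟨U, hU, hUκ⟩ := hκ.2 _ Filter.atTop inferInstance hcomplete
  refine ⟨U, hUκ, fun b => hU (Filter.mem_atTop_sets.2 ⟨⟨{b}, ?_⟩, fun W hW => hW rfl⟩)⟩
  rw [Cardinal.mk_singleton]
  exact Cardinal.one_lt_aleph0.trans hκ.1

end StronglyCompact

namespace AEC

open FirstOrder.Language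

variable {L : FirstOrder.Language.{u, u}} {K : AEC L}

/-! ### The small types form a set -/

section Small

variable {M : Type u} [L.Structure M]

theorem exists_tp_eq_of_equiv {J N : Type u} [L.Structure N] {e : M ↪[L] N} (he : K.IsEmb e)
    (a : J → N) {B : Type u} (f : N ≃ B) :
    ∃ (_ : L.Structure B) (e' : M ↪[L] B) (he' : K.IsEmb e') (a' : J → B),
      tp e' he' a' = tp e he a := by
  let _ : L.Structure B := f.inducedStructure
  have hf : K.IsEmb (f.inducedStructureEquiv (L := L)).toEmbedding := isEmb_equiv _ he.mod_right
  exact ⟨inferInstance, _, _, _, tp_comp he a hf⟩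

/-- There is only a set of Galois types of a given length over a given model. -/
instance small_galoisType (J : Type u) : Small.{u} (K.GaloisType M J) := by
  -- By Löwenheim–Skolem every type is realized in a model of size at most `lam`, which can be
  -- copied onto a subset of the fixed set `lam.out`.
  let lam : Cardinal.{u} := #M + #J + K.LS
  let C : Type u := Σ (s : Set lam.out) (_ : L.Structure s),
    {e : M ↪[L] s // K.IsEmb e} × (J → s)
  let F : C → K.GaloisType M J := fun ⟨s, str, e, a⟩ => tp (N := s) e.1 e.2 a
  refine small_of_surjective (f := F) fun t => ?_
  induction t using Quotient.inductionOn with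
  | h p =>
  obtain ⟨S, hS, hsub, hcard⟩ := exists_strong_superset p.isEmb.mod_right
    (A := Set.range p.emb ∪ Set.range p.seq) (μ := lam) le_add_self
    ((Cardinal.mk_union_le _ _).trans ((add_le_add Cardinal.mk_range_le
      Cardinal.mk_range_le).trans le_self_add))
  let e : M ↪[L] S := Embedding.codRestrict S p.emb fun m => hsub (Or.inl ⟨m, rfl⟩)
  have he : K.IsEmb e := IsEmb.of_comp (g := S.subtype) p.isEmb (isEmb_subtype hS)
  let a : J → S := fun j => ⟨p.seq j, hsub (Or.inr ⟨j, rfl⟩)⟩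
  have hp : tp p.emb p.isEmb p.seq = tp e he a := tp_comp he a (isEmb_subtype hS)
  rw [← Cardinal.mk_out lam, Cardinal.le_def] at hcard
  obtain ⟨g⟩ := hcard
  obtain ⟨str, e', he', a', h⟩ := exists_tp_eq_of_equiv he a (Equiv.ofInjective g g.injective)
  exact ⟨⟨Set.range g, str, ⟨e', he'⟩, a'⟩, h.trans hp.symm⟩

/-- Strong compactness concerns filters on sets in `Type u`, while small types live one universe
higher; this provides the copy on which the fine ultrafilter is built. -/
instance small_smallType (κ : Cardinal.{u}) (I : Type u) : Small.{u} (K.SmallType M κ I) := by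
  let F : K.SmallType M κ I →
      Σ (s : Set I) (D : L.Substructure M), K.GaloisType D s := fun p => ⟨p.length, p.dom, p.type⟩
  refine small_of_injective (f := F) fun p q hpq => ?_
  obtain ⟨s, hs, D, hD, hD', t⟩ := p
  obtain ⟨s', hs', E, hE, hE', t'⟩ := q
  simp only [F, Sigma.mk.injEq] at hpq
  obtain ⟨rfl, hpq⟩ := hpq
  rw [heq_eq_eq, Sigma.mk.injEq] at hpq
  obtain ⟨rfl, hpq⟩ := hpq
  rw [heq_eq_eq] at hpq
  subst hpq
  rfl

end Small

/-! ### The compactness argument -/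

variable {M : Type u} [L.Structure M] {κ : Cardinal.{u}} {I : Type u}

theorem Consistent.ltConsistent {X Y : Set (K.SmallType M κ I)} (h : Consistent X Y) :
    LTConsistent X Y := by
  obtain ⟨N, _, e, he, a, hX, hY⟩ := h
  exact fun X₀ Y₀ hX₀ hY₀ _ _ =>
    ⟨N, inferInstance, e, he, a, fun p hp => hX p (hX₀ hp), fun q hq => hY q (hY₀ hq)⟩

theorem LTConsistent.consistent
    (hne : ∀ (N : Type u) [L.Structure N], K.Mod N → Nonempty N)
    (hκ : IsStronglyCompact κ) (hLS : K.LS < κ)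
    {X Y : Set (K.SmallType M κ I)} (h : LTConsistent X Y) : Consistent X Y := by
  let B : Type u := Shrink.{u} (K.SmallType M κ I)
  let c : K.SmallType M κ I ≃ B := equivShrink _
  obtain ⟨U, hU, hfine⟩ := hκ.exists_fine B
  have hcard : ∀ (Z : {Z : Set B // #Z < κ}) (W : Set (K.SmallType M κ I)),
      #(W ∩ c ⁻¹' Z.1 : Set (K.SmallType M κ I)) < Cardinal.lift.{u + 1} κ := by
    intro Z W
    refine (Cardinal.mk_le_mk_of_subset Set.inter_subset_right).trans_lt ?_
    have h1 := Cardinal.mk_preimage_of_injective_lift c Z.1 c.injective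
    rw [Cardinal.lift_id'.{u, u + 1}] at h1
    exact h1.trans_lt (Cardinal.lift_lt.2 Z.2)
  choose N str e he a hX hY using fun Z : {Z : Set B // #Z < κ} =>
    h (X ∩ c ⁻¹' Z.1) (Y ∩ c ⁻¹' Z.1) Set.inter_subset_left Set.inter_subset_left
      (hcard Z X) (hcard Z Y)
  have : ∀ Z, Nonempty (N Z) := fun Z => hne _ (he Z).mod_right
  refine ⟨(U : Filter _).Product N, inferInstance, diagonal U e, isEmb_diagonal U hLS e he,
    fun j => toProduct U fun Z => a Z j, fun p hp => ?_, fun q hq hreal => ?_⟩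
  · obtain ⟨Z, h1, h2⟩ := ((eventually_realizedBy_iff U hLS e he a p).and (hfine (c p))).exists
    exact h1.1 (hX Z p ⟨hp, h2⟩)
  · obtain ⟨Z, h1, h2⟩ := ((eventually_realizedBy_iff U hLS e he a q).and (hfine (c q))).exists
    exact hY Z q ⟨hq, h2⟩ (h1.2 hreal)

end AEC

theorem mainTheorem8 {L : FirstOrder.Language.{u, u}} (K : AEC L)
    (hsize : ∀ (N : Type u) [L.Structure N], K.Mod N → K.LS ≤ #N)
    (κ : Cardinal.{u}) (hκ : IsStronglyCompact κ) (hLS : K.LS < κ)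
    (M : Type u) [L.Structure M] (hM : K.Mod M)
    (I : Type u) [LinearOrder I]
    (X Y : Set (K.SmallType M κ I)) :
    AEC.Consistent X Y ↔ AEC.LTConsistent X Y := by
  refine ⟨AEC.Consistent.ltConsistent, AEC.LTConsistent.consistent (fun N _ hN => ?_) hκ hLS⟩
  rw [← Cardinal.mk_ne_zero_iff]
  -- The size convention enters only to make all factors of the ultraproduct nonempty.
  exact (Cardinal.aleph0_pos.trans_le (K.aleph0_le_LS.trans (hsize N hN))).ne'
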